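/- Let $k\ge 1$ be an integer. Around each point $p$ of the plane, divide the plane into $k$ equal sectors with apex $p$ such that one of the $k$ bounding rays is horizontal and directed to the right. (The first bounding ray of a sector in counterclockwise order belongs to it, the second one does not.) A finite set $P$ of points in the plane is in general position (with respect to $k$) if no point of $P$ lies on a sector-bounding ray of another point of $P$, and no two distinct points of $P$ are at the same distance from some $p\in P$ and within the same sector of $p$. Given such a set $P$ and an order of its points, the corresponding $k$-sector ordered Yao graph is the directed graph on $P$ in which each point sends an edge to its closest (in the Euclidean distance) predecessor in each of its $k$ sectors that contains a predecessor. For $n\ge 1$, let $d_k(n)$ be the maximum integer $D$ with the following property: for every $n$-point set in the plane in general position there exists an order such that the corresponding $k$-sector ordered Yao graph has maximum indegree at least $D$. Theorem. The maximum defining $d_k(n)$ exists for all $k,n\ge 1$, and the following bounds hold: 1. $d_1(n)=\Theta(\log n)$ as $n\to\infty$; 2. $\frac12(n-1)\le d_3(n)\le 5\left\lceil \frac n6\right\rceil-1$ for all $n\ge 1$; 3. $\frac23(n-1)\le d_5(n)\le n-1$ for all $n\ge 1$; 4. $d_k(n)=n-1$ for all $n\ge 1$ if $k=2$, $k=4$,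 or $k\ge 6$. -/

import Mathlib

open Asymptotics Filter

/-- The `i`-th of the `k` sector-bounding rays emanating from the origin of the plane `ℂ`
(without its endpoint), in counterclockwise order; the ray number `0` is horizontal and
directed to the right. -/
def sectorRay (k i : ℕ) : Set ℂ :=
  {z | ∃ r : ℝ, 0 < r ∧
    z = (r : ℂ) * Complex.exp (((2 * Real.pi * i / k : ℝ) : ℂ) * Complex.I)}

/-- The `i`-th of the `k` equal sectors at the origin (without the origin): the nonzero points
whose direction lies between the rays number `i` (included) and `i + 1` (excluded).
The `i`-th sector of a point `p` consists of all `q` such that `q - p ∈ sector k i`. -/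
def sector (k i : ℕ) : Set ℂ :=
  {z | ∃ r θ : ℝ, 0 < r ∧
    θ ∈ Set.Ico (2 * Real.pi * i / k) (2 * Real.pi * (i + 1) / k) ∧
    z = (r : ℂ) * Complex.exp ((θ : ℂ) * Complex.I)}

/-- General position with respect to the `k` sectors: no point of `P` lies on a sector-bounding
ray of another point of `P`, and no two different points of `P` are at the same distance
from a point `p` of `P` and within the same sector of `p`. -/
def InGeneralPosition (k : ℕ) (P : Finset ℂ) : Prop :=
  (∀ p ∈ P, ∀ q ∈ P, ∀ i < k, q - p ∉ sectorRay k i) ∧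
  (∀ p ∈ P, ∀ q ∈ P, ∀ r ∈ P, ∀ i < k, q - p ∈ sector k i → r - p ∈ sector k i →
    dist p q = dist p r → q = r)

/-- The `k`-sector ordered Yao graph of a planar `n`-point set `P`, where `pos p` is the position
of the point `p` in the chosen order: each point `p` sends an edge to its closest predecessor
in each of the `k` sectors of `p` that contains a predecessor. -/
def orderedYaoGraph (k : ℕ) {n : ℕ} (P : Finset ℂ) (pos : P ≃ Fin n) : Digraph P where
  Adj p q := pos q < pos p ∧ ∃ i < k, (q : ℂ) - (p : ℂ) ∈ sector k i ∧
    ∀ r : P, pos r < pos p → (r : ℂ) - (p : ℂ) ∈ sector k i →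
      dist (p : ℂ) (q : ℂ) ≤ dist (p : ℂ) (r : ℂ)

/-- The number of edges of `G` that end at `v`. -/
noncomputable def indegree {V : Type*} (G : Digraph V) (v : V) : ℕ :=
  {u | G.Adj u v}.ncard

/-- The maximum indegree of a finite directed graph. -/
noncomputable def maxIndegree {V : Type*} [Fintype V] (G : Digraph V) : ℕ :=
  Finset.univ.sup (indegree G)

/-- The integers `D` such that every planar `n`-point set in general position has an order
whose `k`-sector ordered Yao graph has maximum indegree at least `D`. -/
def guaranteedIndegrees (k n : ℕ) : Set ℕ :=
  {D | ∀ P : Finset ℂ, P.card = n → InGeneralPosition k P →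
    ∃ pos : P ≃ Fin n, D ≤ maxIndegree (orderedYaoGraph k P pos)}

/-- The number `d_k(n)`: the largest maximum indegree that can be guaranteed in a `k`-sector
ordered Yao graph on `n` points by picking a suitable order. -/
noncomputable def yaoD (k n : ℕ) : ℕ :=
  sSup (guaranteedIndegrees k n)

open MeasureTheory

/-! ### Sectors and rays -/

/-! Lower bounds. Fix a target `v` and a set `S` of other points, and place `v` first. A point `u`
of `S` loses its edge to `v` only if some earlier `w` lies in the sector of `u` that contains `v`
and is closer to `u` than `v` is. If this blocking relation on `S` decreases a potential, ordering
`S` by decreasing potential, with all remaining points last, gives `v` indegree at least `S.card`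
(`exists_order_of_potential`). For even `k` take `v` topmost: blockers lie strictly above `u`. For
`k ≥ 6` sectors span at most 60 degrees, so blockers are nearer to `v`. For `k = 3` a topmost `v`
lies in one of two sectors of each `u`; the larger class has all its blockers in a fixed half-plane
direction. For `k = 5` a leftmost `v` lies in one of three sectors; after the smallest class is
dropped, either the other two sectors fit together in a half-plane or the vertical distance to `v`
is a potential. For `k = 1` a grid pigeonhole argument produces logarithmically many points whose
distances to `v` pairwise differ by a factor above 2, and blockers are then nearer to `v`.

Upper bounds. Tiny generic perturbations of explicit configurations suffice. For `k = 1`,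
near-integer points on a line force the distances of in-neighbours on each side of `v` to double.
For `k = 3`, there are six clusters such that, for every cluster, two others block each other; so
the in-neighbourhood of a point misses a whole cluster. -/

theorem sector_polar {k i : ℕ} {z : ℂ} (h : z ∈ sector k i) :
    ∃ r θ : ℝ, 0 < r ∧ 2 * Real.pi * i / k ≤ θ ∧ θ < 2 * Real.pi * (i + 1) / k ∧
      z.re = r * Real.cos θ ∧ z.im = r * Real.sin θ ∧ ‖z‖ = r := by
  obtain ⟨r, θ, hr, hθ, rfl⟩ := h
  refine ⟨r, θ, hr, hθ.1, hθ.2, ?_, ?_, ?_⟩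
  · rw [Complex.re_ofReal_mul, Complex.exp_ofReal_mul_I_re]
  · rw [Complex.im_ofReal_mul, Complex.exp_ofReal_mul_I_im]
  · rw [norm_mul, Complex.norm_exp_ofReal_mul_I, Complex.norm_real, mul_one, Real.norm_of_nonneg hr.le]

theorem zero_notMem_sector (k i : ℕ) : (0 : ℂ) ∉ sector k i := by
  intro h
  obtain ⟨r, θ, hr, -, -, -, -, h⟩ := sector_polar h
  rw [norm_zero] at h
  exact hr.ne h

theorem zero_notMem_sectorRay (k i : ℕ) : (0 : ℂ) ∉ sectorRay k i := by
  rintro ⟨r, hr, h⟩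
  have := congrArg norm h
  rw [norm_mul, Complex.norm_exp_ofReal_mul_I, Complex.norm_real, mul_one, norm_zero,
    Real.norm_of_nonneg hr.le] at this
  exact hr.ne this

theorem exists_mem_sector {k : ℕ} (hk : 0 < k) {z : ℂ} (hz : z ≠ 0) :
    ∃ i < k, z ∈ sector k i := by
  have hk' : (0 : ℝ) < k := by exact_mod_cast hk
  have hpi := Real.two_pi_pos
  set θ := toIcoMod Real.two_pi_pos 0 (Complex.arg z) with hθ
  have hmem : θ ∈ Set.Ico 0 (0 + 2 * Real.pi) := toIcoMod_mem_Ico _ _ _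
  rw [zero_add] at hmem
  have hx : 0 ≤ θ * k / (2 * Real.pi) := by have := hmem.1; positivity
  refine ⟨⌊θ * k / (2 * Real.pi)⌋₊, ?_, ‖z‖, θ, norm_pos_iff.2 hz, ⟨?_, ?_⟩, ?_⟩
  · rw [Nat.floor_lt hx, div_lt_iff₀ hpi]
    nlinarith [hmem.2]
  · have := Nat.floor_le hx
    rw [le_div_iff₀ hpi] at this
    rw [div_le_iff₀ hk']
    linarith
  · have := Nat.lt_floor_add_one (θ * k / (2 * Real.pi))
    rw [div_lt_iff₀ hpi] at this
    rw [lt_div_iff₀ hk']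
    linarith
  · conv_lhs => rw [← Complex.norm_mul_exp_arg_mul_I z]
    congr 1
    rw [Complex.exp_eq_exp_iff_exists_int]
    refine ⟨toIcoDiv Real.two_pi_pos 0 (Complex.arg z), ?_⟩
    have := toIcoMod_add_toIcoDiv_zsmul Real.two_pi_pos 0 (Complex.arg z)
    rw [← hθ, zsmul_eq_mul] at this
    conv_lhs => rw [← this]
    push_cast
    ring

theorem sector_index_unique {k i j : ℕ} (hi : i < k) (hj : j < k) {z : ℂ}
    (h : z ∈ sector k i) (h' : z ∈ sector k j) : i = j := by
  have hk : (0 : ℝ) < k := by exact_mod_cast (Nat.zero_le i).trans_lt hi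
  have hpi := Real.two_pi_pos
  obtain ⟨r, θ, hr, h1, h2, hre, him, hn⟩ := sector_polar h
  obtain ⟨r', θ', hr', h1', h2', hre', him', hn'⟩ := sector_polar h'
  rw [div_le_iff₀ hk] at h1 h1'
  rw [lt_div_iff₀ hk] at h2 h2'
  have hrr : r' = r := hn'.symm.trans hn
  subst hrr
  have hi1 : (i : ℝ) + 1 ≤ k := by exact_mod_cast hi
  have hj1 : (j : ℝ) + 1 ≤ k := by exact_mod_cast hj
  have hi0 : (0 : ℝ) ≤ i := i.cast_nonneg
  have hj0 : (0 : ℝ) ≤ j := j.cast_nonneg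
  have bound : ∀ {t m : ℝ}, 0 ≤ m → m + 1 ≤ k → 2 * Real.pi * m ≤ t * k →
      t * k < 2 * Real.pi * (m + 1) → 0 ≤ t ∧ t < 2 * Real.pi := by
    intro t m hm hm1 ha hb
    constructor
    · by_contra! ht
      nlinarith [mul_nonneg hpi.le hm]
    · by_contra! ht
      nlinarith [mul_le_mul_of_nonneg_left hm1 hpi.le]
  obtain ⟨t0, t1⟩ := bound hi0 hi1 h1 h2
  obtain ⟨t0', t1'⟩ := bound hj0 hj1 h1' h2'
  have hc : Real.cos θ = Real.cos θ' := mul_left_cancel₀ hr.ne' (hre.symm.trans hre')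
  have hs : Real.sin θ = Real.sin θ' := mul_left_cancel₀ hr.ne' (him.symm.trans him')
  have hang : (θ : Real.Angle) = θ' := Real.Angle.cos_sin_inj hc hs
  obtain ⟨m, hm⟩ := Real.Angle.angle_eq_iff_two_pi_dvd_sub.1 hang
  have hm0 : m = 0 := by
    have hlt : (m : ℝ) < 1 := by
      by_contra! hcon
      nlinarith
    have hgt : (-1 : ℝ) < m := by
      by_contra! hcon
      nlinarith
    have a : m < 1 := by exact_mod_cast hlt
    have b : -1 < m := by exact_mod_cast hgt
    omega
  rw [hm0, Int.cast_zero, mul_zero, sub_eq_zero] at hm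
  subst hm
  have a : (i : ℝ) < j + 1 := by
    by_contra! hcon
    nlinarith [mul_le_mul_of_nonneg_left hcon hpi.le]
  have b : (j : ℝ) < i + 1 := by
    by_contra! hcon
    nlinarith [mul_le_mul_of_nonneg_left hcon hpi.le]
  have a' : i < j + 1 := by exact_mod_cast a
  have b' : j < i + 1 := by exact_mod_cast b
  omega

/-! ### Point sets in general position -/

theorem volume_perpBisector {a b : ℂ} (h : a ≠ b) :
    volume (AffineSubspace.perpBisector a b : Set ℂ) = 0 :=
  Measure.addHaar_affineSubspace _ _ (by rwa [Ne, AffineSubspace.perpBisector_eq_top])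

/-- The forbidden positions of a new point form a null set: circles through old points around old
points, bisectors of pairs of old points, and the lines carrying the rays. An open nonempty set has
positive measure, hence contains an allowed position. -/
theorem exists_insert_generalPosition (k : ℕ) {P : Finset ℂ} (hP : InGeneralPosition k P)
    {U : Set ℂ} (hU : IsOpen U) (hne : U.Nonempty) :
    ∃ q ∈ U, q ∉ P ∧ InGeneralPosition k (insert q P) := by
  let e : ℕ → ℂ := fun i => Complex.exp (((2 * Real.pi * i / k : ℝ) : ℂ) * Complex.I)
  have he : ∀ i, e i ≠ 0 := fun i => Complex.exp_ne_zero _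
  let N1 : Set ℂ := ⋃ p ∈ P, ⋃ r ∈ P, Metric.sphere p (dist p r)
  let N2 : Set ℂ := ⋃ p ∈ P, ⋃ r ∈ P, ⋃ _ : p ≠ r, AffineSubspace.perpBisector p r
  -- The line through `p` in direction `e i`, written as a bisector so that the same null-set lemma
  -- applies. Full lines exclude both `q` on a ray of `p` and `p` on a ray of `q`.
  let N3 : Set ℂ := ⋃ p ∈ P, ⋃ i : ℕ,
    AffineSubspace.perpBisector (p + Complex.I * e i) (p - Complex.I * e i)
  have h1 : volume N1 = 0 := by
    refine (measure_biUnion_null_iff P.countable_toSet).2 fun p _ =>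
      (measure_biUnion_null_iff P.countable_toSet).2 fun r _ => Measure.addHaar_sphere _ _ _
  have h2 : volume N2 = 0 := by
    refine (measure_biUnion_null_iff P.countable_toSet).2 fun p _ =>
      (measure_biUnion_null_iff P.countable_toSet).2 fun r _ =>
        measure_iUnion_null fun h => volume_perpBisector h
  have h3 : volume N3 = 0 := by
    refine (measure_biUnion_null_iff P.countable_toSet).2 fun p _ =>
      measure_iUnion_null fun i => volume_perpBisector ?_
    intro h
    have h' : Complex.I * e i = 0 := by linear_combination h / 2
    exact (mul_ne_zero Complex.I_ne_zero (he i)) h'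
  have hex : ∃ q ∈ U, q ∉ N1 ∪ N2 ∪ N3 := by
    by_contra! hcon
    exact (hU.measure_pos volume hne).ne'
      (measure_mono_null hcon (measure_union_null (measure_union_null h1 h2) h3))
  obtain ⟨q, hqU, hq⟩ := hex
  have hsph : ∀ p ∈ P, ∀ r ∈ P, dist p q ≠ dist p r := by
    intro p hp r hr h
    refine hq (Or.inl (Or.inl ?_))
    simp only [N1, Set.mem_iUnion]
    exact ⟨p, hp, r, hr, by rwa [Metric.mem_sphere, dist_comm]⟩
  have hbis : ∀ p ∈ P, ∀ r ∈ P, dist q p = dist q r → p = r := by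
    intro p hp r hr h
    by_contra hpr
    refine hq (Or.inl (Or.inr ?_))
    simp only [N2, Set.mem_iUnion]
    exact ⟨p, hp, r, hr, hpr, AffineSubspace.mem_perpBisector_iff_dist_eq.2 h⟩
  have hline : ∀ p ∈ P, ∀ i : ℕ, ∀ t : ℝ, q ≠ p + t * e i := by
    intro p hp i t h
    refine hq (Or.inr ?_)
    simp only [N3, Set.mem_iUnion]
    refine ⟨p, hp, i, AffineSubspace.mem_perpBisector_iff_dist_eq.2 ?_⟩
    rw [h, Complex.dist_eq, Complex.dist_eq,
      show p + t * e i - (p + Complex.I * e i) = (t - Complex.I) * e i by ring,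
      show p + t * e i - (p - Complex.I * e i) = (starRingEnd ℂ) (t - Complex.I) * e i by
        simp; ring,
      norm_mul, norm_mul, Complex.norm_conj]
  -- The circles of radius zero in `N1` are what keeps `q` out of `P`.
  refine ⟨q, hqU, fun h => hsph q h q h rfl, ?_, ?_⟩
  · intro p hp r hr i hi
    rw [Finset.mem_insert] at hp hr
    rcases hp with rfl | hp <;> rcases hr with rfl | hr
    · rw [sub_self]; exact zero_notMem_sectorRay k i
    · rintro ⟨t, -, h⟩
      refine hline r hr i (-t) ?_
      push_cast
      linear_combination -h
    · rintro ⟨t, -, h⟩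
      refine hline p hp i t ?_
      linear_combination h
    · exact hP.1 p hp r hr i hi
  · intro p hp x hx y hy i hi hxs hys hd
    rw [Finset.mem_insert] at hp hx hy
    rcases hp with rfl | hp
    · have hx' : x ∈ P := hx.resolve_left fun h => zero_notMem_sector k i (by simpa [h] using hxs)
      have hy' : y ∈ P := hy.resolve_left fun h => zero_notMem_sector k i (by simpa [h] using hys)
      exact hbis x hx' y hy' hd
    · rcases hx with rfl | hx <;> rcases hy with rfl | hy
      · rfl
      · exact (hsph p hp y hy hd).elim
      · exact (hsph p hp x hx hd.symm).elim
      · exact hP.2 p hp x hx y hy i hi hxs hys hd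

theorem exists_generalPosition (k : ℕ) (U : ℕ → Set ℂ) (hU : ∀ i, IsOpen (U i))
    (hne : ∀ i, (U i).Nonempty) (n : ℕ) :
    ∃ p : ℕ → ℂ, (∀ i < n, p i ∈ U i) ∧ Set.InjOn p (Finset.range n) ∧
      InGeneralPosition k ((Finset.range n).image p) := by
  induction n with
  | zero => exact ⟨fun _ => 0, by simp, by simp, by simp [InGeneralPosition]⟩
  | succ n ih =>
    obtain ⟨p, hpU, hinj, hgp⟩ := ih
    obtain ⟨q, hqU, hqP, hq⟩ := exists_insert_generalPosition k hgp (hU n) (hne n)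
    have hold : ∀ i ∈ Finset.range n, Function.update p n q i = p i := fun i hi =>
      Function.update_of_ne (Finset.mem_range.1 hi).ne _ _
    have himg : (Finset.range n).image (Function.update p n q) = (Finset.range n).image p :=
      Finset.image_congr fun i hi => hold i hi
    refine ⟨Function.update p n q, ?_, ?_, ?_⟩
    · intro i hi
      rcases Nat.lt_succ_iff_lt_or_eq.1 hi with h | rfl
      · rw [hold i (Finset.mem_range.2 h)]; exact hpU i h
      · rwa [Function.update_self]
    · rw [Finset.range_add_one, Finset.coe_insert, Set.injOn_insert (by simp)]
      refine ⟨fun i hi j hj h => hinj hi hj ?_, ?_⟩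
      · rwa [hold i hi, hold j hj] at h
      · rw [← Finset.coe_image, himg, Function.update_self]
        exact_mod_cast hqP
    · rwa [Finset.range_add_one, Finset.image_insert, himg, Function.update_self]

/-! ### Orders and indegrees -/

theorem exists_equiv_strictMono {n : ℕ} {P : Finset ℂ} (hP : P.card = n) {α : Type*}
    [LinearOrder α] (key : P → α) :
    ∃ pos : P ≃ Fin n, ∀ x y, key x < key y → pos x < pos y := by
  let e : Fin n ≃ P := (P.equivFinOfCardEq hP).symm
  refine ⟨((Tuple.sort (key ∘ e)).trans e).symm, fun x y hxy => ?_⟩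
  by_contra! h
  have := Tuple.monotone_sort (key ∘ e) h
  simp only [Function.comp_apply, Equiv.symm_trans_apply, Equiv.apply_symm_apply] at this
  exact this.not_gt hxy

theorem indegree_le_maxIndegree {V : Type*} [Fintype V] (G : Digraph V) (v : V) :
    indegree G v ≤ maxIndegree G :=
  Finset.le_sup (Finset.mem_univ v)

/-- If some potential `f` decreases along the blocking relation on a set `S` of points, then all
points of `S` can be made to send an edge to `v`. -/
theorem exists_order_of_potential {k n : ℕ} {P : Finset ℂ} (hP : P.card = n) {v : ℂ} (hv : v ∈ P)
    {S : Finset ℂ} (hS : S ⊆ P.erase v) (c : ℂ → ℕ) (f : ℂ → ℝ)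
    (hc : ∀ u ∈ S, c u < k ∧ v - u ∈ sector k (c u))
    (hf : ∀ u ∈ S, ∀ w ∈ S, w - u ∈ sector k (c u) → dist u w < dist u v → f w < f u) :
    ∃ pos : P ≃ Fin n, S.card ≤ maxIndegree (orderedYaoGraph k P pos) := by
  -- Three blocks: `v`, then `S` by decreasing `f`, so that a blocker in `S` comes after the point
  -- it blocks, then everything else, too late to block.
  let key : P → ℕ ×ₗ ℝ := fun x =>
    if (x : ℂ) = v then toLex (0, 0) else if (x : ℂ) ∈ S then toLex (1, -f x) else toLex (2, 0)
  obtain ⟨pos, hpos⟩ := exists_equiv_strictMono hP key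
  refine ⟨pos, le_trans ?_ (indegree_le_maxIndegree _ ⟨v, hv⟩)⟩
  have hsub : ((S.subtype (· ∈ P) : Finset P) : Set P) ⊆
      {u | (orderedYaoGraph k P pos).Adj u ⟨v, hv⟩} := by
    intro u hu
    have huS : (u : ℂ) ∈ S := by simpa using hu
    have huv : (u : ℂ) ≠ v := (Finset.mem_erase.1 (hS huS)).1
    have keyu : key u = toLex (1, -f u) := by simp only [key, if_neg huv, if_pos huS]
    refine ⟨hpos _ _ ?_, c u, (hc u huS).1, (hc u huS).2, fun r hr hrs => ?_⟩
    · rw [keyu]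
      simp [key, Prod.Lex.toLex_lt_toLex]
    · by_contra! hlt
      refine hr.not_gt (hpos _ _ ?_)
      have hrv : (r : ℂ) ≠ v := fun h => by simp [h] at hlt
      rw [keyu]
      by_cases hrS : (r : ℂ) ∈ S
      · have := hf u huS r hrS hrs hlt
        simpa [key, hrv, hrS, Prod.Lex.toLex_lt_toLex] using this
      · simp [key, hrv, hrS, Prod.Lex.toLex_lt_toLex]
  calc S.card = (S.subtype (· ∈ P)).card := by
        rw [Finset.card_subtype, Finset.filter_true_of_mem]
        exact fun x hx => Finset.mem_of_mem_erase (hS hx)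
    _ = ((S.subtype (· ∈ P) : Finset P) : Set P).ncard := (Set.ncard_coe_finset _).symm
    _ ≤ _ := Set.ncard_le_ncard hsub (Set.toFinite _)

theorem maxIndegree_le_of_forall {V : Type*} [Fintype V] {G : Digraph V} {D : ℕ}
    (h : ∀ v, indegree G v ≤ D) : maxIndegree G ≤ D :=
  Finset.sup_le fun v _ => h v

theorem maxIndegree_orderedYaoGraph_le (k : ℕ) {n : ℕ} {P : Finset ℂ} (hP : P.card = n)
    (pos : P ≃ Fin n) : maxIndegree (orderedYaoGraph k P pos) ≤ n - 1 := by
  refine maxIndegree_le_of_forall fun v => ?_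
  have hsub : {u | (orderedYaoGraph k P pos).Adj u v} ⊆ ((Finset.univ.erase v : Finset P) : Set P) := by
    intro u hu
    have : pos v < pos u := hu.1
    simpa using fun h : u = v => (h ▸ this).false
  refine (Set.ncard_le_ncard hsub (Finset.finite_toSet _)).trans ?_
  rw [Set.ncard_coe_finset, Finset.card_erase_of_mem (Finset.mem_univ _), Finset.card_univ,
    Fintype.card_coe, hP]

/-- Without such a set the condition on `D` would be vacuous and the supremum defining `yaoD` would
be over an unbounded set. -/
theorem exists_generalPosition_card (k n : ℕ) :
    ∃ P : Finset ℂ, P.card = n ∧ InGeneralPosition k P := by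
  obtain ⟨p, -, hinj, hgp⟩ := exists_generalPosition k (fun _ => Set.univ) (fun _ => isOpen_univ)
    (fun _ => Set.univ_nonempty) n
  exact ⟨_, by rw [Finset.card_image_of_injOn hinj, Finset.card_range], hgp⟩

theorem le_of_mem_guaranteedIndegrees {k n D : ℕ} (h : D ∈ guaranteedIndegrees k n) :
    D ≤ n - 1 := by
  obtain ⟨P, hP, hgp⟩ := exists_generalPosition_card k n
  obtain ⟨pos, hpos⟩ := h P hP hgp
  exact hpos.trans (maxIndegree_orderedYaoGraph_le k hP pos)

theorem bddAbove_guaranteedIndegrees (k n : ℕ) : BddAbove (guaranteedIndegrees k n) :=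
  ⟨n - 1, fun _ h => le_of_mem_guaranteedIndegrees h⟩

theorem isGreatest_yaoD (k n : ℕ) : IsGreatest (guaranteedIndegrees k n) (yaoD k n) := by
  refine ⟨Nat.sSup_mem ⟨0, fun P hP _ => ⟨P.equivFinOfCardEq hP, Nat.zero_le _⟩⟩
    (bddAbove_guaranteedIndegrees k n), fun _ h => le_csSup (bddAbove_guaranteedIndegrees k n) h⟩

theorem yaoD_le_pred (k n : ℕ) : yaoD k n ≤ n - 1 :=
  le_of_mem_guaranteedIndegrees (isGreatest_yaoD k n).1

/-- To bound `yaoD` from above, it suffices to bound all indegrees for one set of points that lie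
in prescribed open sets. -/
theorem yaoD_le_of_family {k n D : ℕ} (U : ℕ → Set ℂ) (hU : ∀ i, IsOpen (U i))
    (hne : ∀ i, (U i).Nonempty)
    (h : ∀ (p : ℕ → ℂ), (∀ i < n, p i ∈ U i) → ∀ S : Finset ℕ, S ⊆ Finset.range n →
      ∀ v < n, v ∉ S → ∀ pos : ℕ → ℕ, Set.InjOn pos (Finset.range n) →
      (∀ u ∈ S, pos v < pos u ∧ ∃ i < k, p v - p u ∈ sector k i ∧
        ∀ r < n, pos r < pos u → p r - p u ∈ sector k i → dist (p u) (p v) ≤ dist (p u) (p r)) →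
      S.card ≤ D) :
    yaoD k n ≤ D := by
  obtain ⟨p, hpU, hinj, hgp⟩ := exists_generalPosition k U hU hne n
  have hcard : ((Finset.range n).image p).card = n := by
    rw [Finset.card_image_of_injOn hinj, Finset.card_range]
  obtain ⟨pos, hpos⟩ := (isGreatest_yaoD k n).1 _ hcard hgp
  refine hpos.trans (maxIndegree_le_of_forall fun v => ?_)
  obtain ⟨v, hv⟩ := v
  obtain ⟨j, hj, rfl⟩ := Finset.mem_image.1 hv
  have hmem : ∀ i < n, p i ∈ (Finset.range n).image p := fun i hi =>
    Finset.mem_image_of_mem p (Finset.mem_range.2 hi)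
  let pos' : ℕ → ℕ := fun i => if hi : i < n then pos ⟨p i, hmem i hi⟩ else 0
  have hpos' : ∀ i (hi : i < n), pos' i = pos ⟨p i, hmem i hi⟩ := fun i hi => dif_pos hi
  classical
  let S : Finset ℕ := (Finset.range n).filter fun i =>
    ∃ hi : i < n, (orderedYaoGraph k _ pos).Adj ⟨p i, hmem i hi⟩ ⟨p j, hv⟩
  have hj' := Finset.mem_range.1 hj
  have key := h p hpU S (Finset.filter_subset _ _) j hj' ?_ pos' ?_ ?_
  · refine le_trans ?_ key
    have himg : {u | (orderedYaoGraph k _ pos).Adj u ⟨p j, hv⟩} ⊆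
        (Subtype.val ⁻¹' (p '' (S : Set ℕ))) := by
      rintro ⟨u, hu⟩ hadj
      obtain ⟨i, hi, rfl⟩ := Finset.mem_image.1 hu
      exact ⟨i, Finset.mem_coe.2 (Finset.mem_filter.2 ⟨hi, Finset.mem_range.1 hi, hadj⟩), rfl⟩
    have hfin : (p '' (S : Set ℕ)).Finite := S.finite_toSet.image p
    calc indegree _ _ = (Subtype.val '' {u | (orderedYaoGraph k _ pos).Adj u ⟨p j, hv⟩}).ncard :=
          (Set.ncard_image_of_injective _ Subtype.val_injective).symm
      _ ≤ (p '' (S : Set ℕ)).ncard :=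
          Set.ncard_le_ncard (Set.image_subset_iff.2 himg) hfin
      _ ≤ (S : Set ℕ).ncard := Set.ncard_image_le S.finite_toSet
      _ = S.card := Set.ncard_coe_finset S
  · intro hjS
    obtain ⟨_, _, hadj⟩ := Finset.mem_filter.1 hjS
    exact hadj.1.false
  · intro a ha b hb hab
    have ha' := Finset.mem_range.1 (Finset.mem_coe.1 ha)
    have hb' := Finset.mem_range.1 (Finset.mem_coe.1 hb)
    simp only [hpos' a ha', hpos' b hb'] at hab
    have := pos.injective (Fin.val_injective hab)
    exact hinj ha hb (congrArg Subtype.val this)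
  · intro u hu
    obtain ⟨-, hun, hadj⟩ := Finset.mem_filter.1 hu
    obtain ⟨hlt, i, hi, hs, hmin⟩ := hadj
    refine ⟨?_, i, hi, hs, fun r hr hrlt hrs => ?_⟩
    · rw [hpos' u hun, hpos' j hj']
      exact hlt
    · rw [hpos' u hun, hpos' r hr] at hrlt
      exact hmin ⟨p r, hmem r hr⟩ hrlt hrs

/-- To bound `yaoD` from below, exhibit in every point set a point and an acyclic blocking
relation. -/
theorem le_yaoD_of_potential {k n D : ℕ}
    (h : ∀ P : Finset ℂ, P.card = n → InGeneralPosition k P → ∃ v ∈ P, ∃ S ⊆ P.erase v,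
      D ≤ S.card ∧ ∃ (c : ℂ → ℕ) (f : ℂ → ℝ), (∀ u ∈ S, c u < k ∧ v - u ∈ sector k (c u)) ∧
        ∀ u ∈ S, ∀ w ∈ S, w - u ∈ sector k (c u) → dist u w < dist u v → f w < f u) :
    D ≤ yaoD k n := by
  refine (isGreatest_yaoD k n).2 fun P hP hgp => ?_
  obtain ⟨v, hv, S, hS, hD, c, f, hc, hf⟩ := h P hP hgp
  obtain ⟨pos, hpos⟩ := exists_order_of_potential hP hv hS c f hc hf
  exact ⟨pos, hD.trans hpos⟩

/-- A choice of the sector of each point that contains `v`. -/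
theorem exists_sector_choice {k : ℕ} (hk : 0 < k) (v : ℂ) :
    ∃ c : ℂ → ℕ, ∀ u, u ≠ v → c u < k ∧ v - u ∈ sector k (c u) := by
  have : ∀ u, ∃ i, u ≠ v → i < k ∧ v - u ∈ sector k i := by
    intro u
    by_cases h : u = v
    · exact ⟨0, fun h' => (h' h).elim⟩
    · obtain ⟨i, hi⟩ := exists_mem_sector hk (sub_ne_zero.2 (Ne.symm h))
      exact ⟨i, fun _ => hi⟩
  choose c hc using this
  exact ⟨c, hc⟩

/-! ### Lower bounds for at least two sectors -/

/-- The sector lies within a right angle of direction `α`. The inequality is strict only at the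
first ray, because the second ray is not in the sector. -/
theorem inner_pos_of_mem_sector {k i : ℕ} {z : ℂ} (h : z ∈ sector k i) {α : ℝ}
    (h1 : α - Real.pi / 2 < 2 * Real.pi * i / k)
    (h2 : 2 * Real.pi * (i + 1) / k ≤ α + Real.pi / 2) :
    0 < z.re * Real.cos α + z.im * Real.sin α := by
  obtain ⟨r, θ, hr, ha, hb, hre, him, -⟩ := sector_polar h
  have : z.re * Real.cos α + z.im * Real.sin α = r * Real.cos (θ - α) := by
    rw [hre, him, Real.cos_sub]; ring
  rw [this]
  exact mul_pos hr (Real.cos_pos_of_mem_Ioo ⟨by linarith, by linarith⟩)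

theorem exists_max_im {P : Finset ℂ} (h : P.Nonempty) : ∃ v ∈ P, ∀ u ∈ P, 0 ≤ (v - u).im := by
  obtain ⟨v, hv, hmax⟩ := P.exists_max_image Complex.im h
  exact ⟨v, hv, fun u hu => by simpa using hmax u hu⟩

theorem exists_min_re {P : Finset ℂ} (h : P.Nonempty) : ∃ v ∈ P, ∀ u ∈ P, (v - u).re ≤ 0 := by
  obtain ⟨v, hv, hmin⟩ := P.exists_min_image Complex.re h
  exact ⟨v, hv, fun u hu => by simpa using hmin u hu⟩

theorem pred_le_yaoD_of_even {m n : ℕ} (hm : 0 < m) (hn : 1 ≤ n) : n - 1 ≤ yaoD (2 * m) n := by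
  have hk : 0 < 2 * m := by omega
  have hmR : (0 : ℝ) < m := by exact_mod_cast hm
  have hpi := Real.pi_pos
  refine le_yaoD_of_potential fun P hP hgp => ?_
  have hne : P.Nonempty := Finset.card_pos.1 (by omega)
  obtain ⟨v, hv, hmax⟩ := exists_max_im hne
  obtain ⟨c, hc⟩ := exists_sector_choice hk v
  -- The rays numbered `0` and `m` are horizontal, so general position forbids two points at equal
  -- height; the first `m` sectors make up the upper half-plane.
  have ray : ∀ u ∈ P, ∀ w ∈ P, ∀ i < 2 * m, w - u ∈ sector (2 * m) i → 0 ≤ (w - u).im →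
      i < m ∧ 0 < (w - u).im := by
    intro u hu w hw i hi hs him0
    obtain ⟨r, θ, hr, h1, h2, hre, him, -⟩ := sector_polar hs
    have e1 : 2 * Real.pi * i / (2 * m : ℕ) = Real.pi * (i / m) := by
      push_cast; field_simp
    have e2 : 2 * Real.pi * (i + 1) / (2 * m : ℕ) = Real.pi * ((i + 1) / m) := by
      push_cast; field_simp
    rw [e1] at h1
    rw [e2] at h2
    have nray : ∀ j < 2 * m, θ ≠ 2 * Real.pi * j / (2 * m : ℕ) := by
      intro j hj hθ
      refine hgp.1 u hu w hw j hj ⟨r, hr, ?_⟩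
      rw [← hθ]
      refine Complex.ext ?_ ?_
      · rw [hre, Complex.re_ofReal_mul, Complex.exp_ofReal_mul_I_re]
      · rw [him, Complex.im_ofReal_mul, Complex.exp_ofReal_mul_I_im]
    have hθ0 : θ ≠ 0 := by simpa using nray 0 hk
    have hθpi : θ ≠ Real.pi := by
      have := nray m (by omega)
      rwa [show 2 * Real.pi * m / (2 * m : ℕ) = Real.pi by push_cast; field_simp] at this
    have hθ1 : 0 < θ := lt_of_le_of_ne (le_trans (by positivity) h1) hθ0.symm
    rcases lt_or_ge i m with him' | him'
    · refine ⟨him', ?_⟩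
      have h3 : (i + 1 : ℝ) / m ≤ 1 := by
        rw [div_le_one hmR]
        exact_mod_cast him'
      rw [him]
      exact mul_pos hr (Real.sin_pos_of_pos_of_lt_pi hθ1 (by nlinarith))
    · have h3 : (1 : ℝ) ≤ i / m := by
        rw [le_div_iff₀ hmR, one_mul]
        exact_mod_cast him'
      have h4 : (i + 1 : ℝ) / m ≤ 2 := by
        rw [div_le_iff₀ hmR]
        exact_mod_cast hi
      have h5 : Real.pi < θ := lt_of_le_of_ne (by nlinarith) hθpi.symm
      have h6 : Real.sin θ < 0 := by
        have := Real.sin_pos_of_pos_of_lt_pi (x := θ - Real.pi) (by linarith) (by nlinarith)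
        rw [Real.sin_sub_pi] at this
        linarith
      rw [him] at him0
      nlinarith
  refine ⟨v, hv, P.erase v, subset_rfl, by rw [Finset.card_erase_of_mem hv, hP], c,
    fun u => -u.im, fun u hu => hc u (Finset.ne_of_mem_erase hu), ?_⟩
  intro u hu w hw hs _
  obtain ⟨huv, huP⟩ := Finset.mem_erase.1 hu
  obtain ⟨hck, hcs⟩ := hc u huv
  obtain ⟨hcm, -⟩ := ray u huP v hv _ hck hcs (hmax u huP)
  have hcm' : (c u + 1 : ℝ) ≤ m := by exact_mod_cast hcm
  have hnonneg : 0 ≤ (w - u).im := by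
    obtain ⟨r, θ, hr, h1, h2, -, him, -⟩ := sector_polar hs
    rw [him]
    refine mul_nonneg hr.le (Real.sin_nonneg_of_nonneg_of_le_pi (le_trans (by positivity) h1)
      (h2.le.trans ?_))
    rw [div_le_iff₀ (by exact_mod_cast hk)]
    push_cast
    nlinarith
  have := (ray u huP w (Finset.mem_of_mem_erase hw) _ hck hs hnonneg).2
  rw [Complex.sub_im] at this
  linarith

/-- By the law of cosines with an angle below 60 degrees, the squared distance is less than `r ^ 2 +
s ^ 2 - r * s`, which is below `r ^ 2` because `s < r`. -/
theorem norm_sub_lt_of_mem_sector {k i : ℕ} (hk : 6 ≤ k) {a b : ℂ} (ha : a ∈ sector k i)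
    (hb : b ∈ sector k i) (h : ‖b‖ < ‖a‖) : ‖a - b‖ < ‖a‖ := by
  obtain ⟨r, θ, hr, h1, h2, hre, him, hn⟩ := sector_polar ha
  obtain ⟨s, φ, hs, h1', h2', hre', him', hn'⟩ := sector_polar hb
  rw [hn, hn'] at h
  have hkR : (6 : ℝ) ≤ k := by exact_mod_cast hk
  have hw : 2 * Real.pi * (i + 1) / k - 2 * Real.pi * i / k ≤ Real.pi / 3 := by
    rw [← sub_div, div_le_iff₀ (by linarith)]
    nlinarith [Real.pi_pos]
  have habs : |θ - φ| < Real.pi / 3 := abs_lt.2 ⟨by linarith, by linarith⟩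
  have hcos : 1 / 2 < Real.cos (θ - φ) := by
    rw [← Real.cos_abs, ← Real.cos_pi_div_three]
    exact Real.cos_lt_cos_of_nonneg_of_le_pi (abs_nonneg _) (by linarith [Real.pi_pos]) habs
  refine lt_of_pow_lt_pow_left₀ 2 (norm_nonneg a) ?_
  have hsq : ‖a - b‖ ^ 2 = r ^ 2 + s ^ 2 - 2 * (r * s) * Real.cos (θ - φ) := by
    rw [← Complex.normSq_eq_norm_sq, Complex.normSq_apply, Complex.sub_re, Complex.sub_im,
      hre, him, hre', him', Real.cos_sub]
    nlinarith [Real.sin_sq_add_cos_sq θ, Real.sin_sq_add_cos_sq φ]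
  rw [hsq, hn]
  nlinarith [mul_pos hr hs]

theorem pred_le_yaoD_of_six_le {k n : ℕ} (hk : 6 ≤ k) (hn : 1 ≤ n) : n - 1 ≤ yaoD k n := by
  refine le_yaoD_of_potential fun P hP _ => ?_
  obtain ⟨v, hv⟩ : P.Nonempty := Finset.card_pos.1 (by omega)
  obtain ⟨c, hc⟩ := exists_sector_choice (by omega : 0 < k) v
  refine ⟨v, hv, P.erase v, subset_rfl, by rw [Finset.card_erase_of_mem hv, hP], c,
    fun u => dist u v, fun u hu => hc u (Finset.ne_of_mem_erase hu), ?_⟩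
  intro u hu w _ hs hd
  have hcs := (hc u (Finset.ne_of_mem_erase hu)).2
  have := norm_sub_lt_of_mem_sector hk hcs hs (by
    rwa [dist_comm u w, dist_comm u v, dist_eq_norm, dist_eq_norm] at hd)
  rwa [sub_sub_sub_cancel_right, ← dist_eq_norm, ← dist_eq_norm, dist_comm v w, dist_comm v u]
    at this

theorem half_le_yaoD_three {n : ℕ} (hn : 1 ≤ n) : n / 2 ≤ yaoD 3 n := by
  have hpi := Real.pi_pos
  refine le_yaoD_of_potential fun P hP _ => ?_
  have hne : P.Nonempty := Finset.card_pos.1 (by omega)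
  obtain ⟨v, hv, hmax⟩ := exists_max_im hne
  obtain ⟨c, hc⟩ := exists_sector_choice (by norm_num : 0 < 3) v
  have hc01 : ∀ u ∈ P.erase v, c u ≠ 0 → c u = 1 := by
    intro u hu h0
    obtain ⟨huv, huP⟩ := Finset.mem_erase.1 hu
    obtain ⟨hck, hcs⟩ := hc u huv
    by_contra h1
    have h2 : c u = 2 := by omega
    rw [h2] at hcs
    have ha := inner_pos_of_mem_sector hcs (α := 3 * Real.pi / 2) (by push_cast; linarith)
      (by push_cast; linarith)
    rw [show 3 * Real.pi / 2 = Real.pi / 2 + Real.pi by ring, Real.cos_add_pi, Real.sin_add_pi,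
      Real.cos_pi_div_two, Real.sin_pi_div_two] at ha
    linarith [hmax u huP]
  have hsplit := Finset.card_filter_add_card_filter_not (s := P.erase v) (fun u => c u = 0)
  rw [Finset.card_erase_of_mem hv, hP] at hsplit
  -- A sector of 120 degrees fits in a half-plane, so the linear functional along its bisector `α`
  -- is a potential. The floor `n / 2` equals the ceiling of `(n - 1) / 2`.
  have main : ∀ S ⊆ P.erase v, n / 2 ≤ S.card → (∃ j, (∀ u ∈ S, c u = j) ∧ ∃ α : ℝ,
      α - Real.pi / 2 < 2 * Real.pi * j / (3 : ℕ) ∧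
      2 * Real.pi * (j + 1) / (3 : ℕ) ≤ α + Real.pi / 2) →
      ∃ v ∈ P, ∃ S ⊆ P.erase v,
      n / 2 ≤ S.card ∧ ∃ (c : ℂ → ℕ) (f : ℂ → ℝ), (∀ u ∈ S, c u < 3 ∧ v - u ∈ sector 3 (c u)) ∧
        ∀ u ∈ S, ∀ w ∈ S, w - u ∈ sector 3 (c u) → dist u w < dist u v → f w < f u := by
    rintro S hS hcard ⟨j, hj, α, h1, h2⟩
    refine ⟨v, hv, S, hS, hcard, c, fun u => -(u.re * Real.cos α + u.im * Real.sin α),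
      fun u hu => hc u (Finset.ne_of_mem_erase (hS hu)), fun u hu w _ hs _ => ?_⟩
    rw [hj u hu] at hs
    have := inner_pos_of_mem_sector hs h1 h2
    rw [Complex.sub_re, Complex.sub_im] at this
    linarith
  by_cases hle : n / 2 ≤ ((P.erase v).filter fun u => c u = 0).card
  · refine main _ (Finset.filter_subset _ _) hle
      ⟨0, fun u hu => (Finset.mem_filter.1 hu).2, Real.pi / 3, ?_, ?_⟩ <;> push_cast <;> linarith
  · refine main _ (Finset.filter_subset _ _) (?_ : n / 2 ≤ ((P.erase v).filter fun u => ¬ c u = 0).card)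
      ⟨1, fun u hu => hc01 u (Finset.mem_filter.1 hu).1 (Finset.mem_filter.1 hu).2,
        Real.pi, ?_, ?_⟩
    · omega
    all_goals push_cast; linarith

/-- These sectors deviate from the vertical by at most 54 degrees, which is less than 60. -/
theorem half_lt_abs_im_of_mem_sector_five {i : ℕ} {z : ℂ} (h : z ∈ sector 5 i) :
    (i = 1 → ‖z‖ < 2 * z.im) ∧ (i = 3 → ‖z‖ < 2 * -z.im) := by
  have hpi := Real.pi_pos
  obtain ⟨r, θ, hr, h1, h2, -, him, hn⟩ := sector_polar h
  have key : ∀ x : ℝ, |x| < Real.pi / 3 → 1 / 2 < Real.cos x := by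
    intro x hx
    rw [← Real.cos_abs, ← Real.cos_pi_div_three]
    exact Real.cos_lt_cos_of_nonneg_of_le_pi (abs_nonneg _) (by linarith) hx
  constructor
  · rintro rfl
    have := key (θ - Real.pi / 2) (abs_lt.2 (by push_cast at h1 h2; constructor <;> linarith))
    rw [Real.cos_sub_pi_div_two] at this
    rw [him, hn]
    nlinarith
  · rintro rfl
    have := key (θ - Real.pi - Real.pi / 2)
      (abs_lt.2 (by push_cast at h1 h2; constructor <;> linarith))
    rw [Real.cos_sub_pi_div_two, Real.sin_sub_pi] at this
    rw [him, hn]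
    nlinarith

theorem two_thirds_le_yaoD_five {n : ℕ} (hn : 1 ≤ n) : 2 * n / 3 ≤ yaoD 5 n := by
  have hpi := Real.pi_pos
  refine le_yaoD_of_potential fun P hP _ => ?_
  have hne : P.Nonempty := Finset.card_pos.1 (by omega)
  obtain ⟨v, hv, hmin⟩ := exists_min_re hne
  obtain ⟨c, hc⟩ := exists_sector_choice (by norm_num : 0 < 5) v
  have hc123 : ∀ u ∈ P.erase v, c u = 1 ∨ c u = 2 ∨ c u = 3 := by
    intro u hu
    obtain ⟨huv, huP⟩ := Finset.mem_erase.1 hu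
    obtain ⟨hck, hcs⟩ := hc u huv
    have hre := hmin u huP
    have h0 : c u ≠ 0 := by
      intro h
      rw [h] at hcs
      have ha := inner_pos_of_mem_sector hcs (α := 0) (by push_cast; linarith)
        (by push_cast; linarith)
      rw [Real.cos_zero, Real.sin_zero] at ha
      linarith
    have h4 : c u ≠ 4 := by
      intro h
      rw [h] at hcs
      have ha := inner_pos_of_mem_sector hcs (α := 2 * Real.pi) (by push_cast; linarith)
        (by push_cast; linarith)
      rw [Real.cos_two_pi, Real.sin_two_pi] at ha
      linarith
    omega
  have hcount : ∀ j, ((P.erase v).filter fun u => c u ≠ j).card +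
      ((P.erase v).filter fun u => c u = j).card = n - 1 := by
    intro j
    rw [add_comm, Finset.card_filter_add_card_filter_not, Finset.card_erase_of_mem hv, hP]
  have hsum : ((P.erase v).filter fun u => c u = 1).card +
      ((P.erase v).filter fun u => c u = 2).card +
      ((P.erase v).filter fun u => c u = 3).card ≤ n - 1 := by
    rw [← Finset.card_union_of_disjoint, ← Finset.card_union_of_disjoint, ← hP,
      ← Finset.card_erase_of_mem hv]
    · exact Finset.card_le_card (Finset.union_subset (Finset.union_subset
        (Finset.filter_subset _ _) (Finset.filter_subset _ _)) (Finset.filter_subset _ _))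
    · rw [Finset.disjoint_left]
      intro x hx hx'
      rw [Finset.mem_union, Finset.mem_filter, Finset.mem_filter] at hx
      rw [Finset.mem_filter] at hx'
      omega
    · rw [Finset.disjoint_left]
      intro x hx hx'
      rw [Finset.mem_filter] at hx hx'
      omega
  have hpick : ∃ j, (j = 1 ∨ j = 2 ∨ j = 3) ∧
      2 * n / 3 ≤ ((P.erase v).filter fun u => c u ≠ j).card := by
    have c1 := hcount 1
    have c2 := hcount 2
    have c3 := hcount 3
    by_contra! hcon
    have d1 := hcon 1 (by simp)
    have d2 := hcon 2 (by simp)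
    have d3 := hcon 3 (by simp)
    omega
  obtain ⟨j, hj, hcard⟩ := hpick
  have hsub : (P.erase v).filter (fun u => c u ≠ j) ⊆ P.erase v := Finset.filter_subset _ _
  have hcS : ∀ u ∈ (P.erase v).filter (fun u => c u ≠ j), c u < 5 ∧ v - u ∈ sector 5 (c u) :=
    fun u hu => hc u (Finset.ne_of_mem_erase (hsub hu))
  -- Used when the dropped sector is `1` or `3`: the two adjacent sectors left span 144 degrees, and
  -- `α` is their common boundary direction.
  have linear : ∀ α : ℝ, (∀ u ∈ (P.erase v).filter (fun u => c u ≠ j),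
      α - Real.pi / 2 < 2 * Real.pi * c u / (5 : ℕ) ∧
      2 * Real.pi * (c u + 1) / (5 : ℕ) ≤ α + Real.pi / 2) →
      ∀ u ∈ (P.erase v).filter (fun u => c u ≠ j), ∀ w ∈ (P.erase v).filter (fun u => c u ≠ j),
      w - u ∈ sector 5 (c u) → dist u w < dist u v →
      -(w.re * Real.cos α + w.im * Real.sin α) < -(u.re * Real.cos α + u.im * Real.sin α) := by
    intro α hα u hu w _ hs _
    have := inner_pos_of_mem_sector hs (hα u hu).1 (hα u hu).2
    rw [Complex.sub_re, Complex.sub_im] at this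
    linarith
  rcases hj with rfl | rfl | rfl
  · refine ⟨v, hv, _, hsub, hcard, c, _, hcS, linear (6 * Real.pi / 5) fun u hu => ?_⟩
    obtain ⟨hu1, hu2⟩ := Finset.mem_filter.1 hu
    rcases hc123 u hu1 with h | h | h
    · exact (hu2 h).elim
    all_goals rw [h]; push_cast; constructor <;> linarith
  -- The sectors `1` and `3` are nearly opposite, so no linear potential serves. The step from `u`
  -- to `w` goes vertically towards `v` by less than `‖v - u‖`, hence by less than twice the height
  -- difference, and so reduces its absolute value.
  · refine ⟨v, hv, _, hsub, hcard, c, fun u => |(v - u).im|, hcS, fun u hu w _ hs hd => ?_⟩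
    obtain ⟨hu1, hu2⟩ := Finset.mem_filter.1 hu
    have hvs := half_lt_abs_im_of_mem_sector_five (hcS u hu).2
    have hws := half_lt_abs_im_of_mem_sector_five hs
    have h1 := Complex.abs_im_le_norm (w - u)
    rw [dist_comm u w, dist_comm u v, dist_eq_norm, dist_eq_norm] at hd
    have h2 := norm_nonneg (w - u)
    have him : (v - w).im = (v - u).im - (w - u).im := by simp
    rw [abs_le] at h1
    simp only [him]
    rcases hc123 u hu1 with h | h | h
    · have := hvs.1 h
      have := hws.1 h
      rw [abs_of_pos (by linarith : 0 < (v - u).im), abs_lt]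
      constructor <;> linarith
    · exact (hu2 h).elim
    · have := hvs.2 h
      have := hws.2 h
      rw [abs_of_neg (by linarith : (v - u).im < 0), abs_lt]
      constructor <;> linarith
  · refine ⟨v, hv, _, hsub, hcard, c, _, hcS, linear (4 * Real.pi / 5) fun u hu => ?_⟩
    obtain ⟨hu1, hu2⟩ := Finset.mem_filter.1 hu
    rcases hc123 u hu1 with h | h | h
    · rw [h]; push_cast; constructor <;> linarith
    · rw [h]; push_cast; constructor <;> linarith
    · exact (hu2 h).elim

/-! ### One sector -/

theorem dist_lt_of_floor_eq {a x y : ℂ} {s : ℝ} (hs : 0 < s)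
    (hre : ⌊(x - a).re / s⌋ = ⌊(y - a).re / s⌋) (him : ⌊(x - a).im / s⌋ = ⌊(y - a).im / s⌋) :
    dist x y < 3 / 2 * s := by
  have h1 := Int.abs_sub_lt_one_of_floor_eq_floor hre
  have h2 := Int.abs_sub_lt_one_of_floor_eq_floor him
  rw [← sub_div, abs_div, abs_of_pos hs, div_lt_one hs, ← Complex.sub_re,
    sub_sub_sub_cancel_right, ← sq_lt_sq₀ (abs_nonneg _) hs.le, sq_abs] at h1
  rw [← sub_div, abs_div, abs_of_pos hs, div_lt_one hs, ← Complex.sub_im,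
    sub_sub_sub_cancel_right, ← sq_lt_sq₀ (abs_nonneg _) hs.le, sq_abs] at h2
  rw [dist_eq_norm]
  refine lt_of_pow_lt_pow_left₀ 2 (by positivity) ?_
  rw [← Complex.normSq_eq_norm_sq, Complex.normSq_apply]
  nlinarith

/-- Recursion into the fullest cell of a grid with side one sixth of the diameter `D`. Offsets from
`a` take 13 values per coordinate, hence `169 = 13 ^ 2`. A cell has diameter below `D / 4`, while
one end of a diametral pair is at least `D / 2` from `v` and supplies the new far point. -/
theorem exists_separated_distances (m : ℕ) : ∀ P : Finset ℂ, 169 ^ m ≤ P.card →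
    ∃ v ∈ P, ∃ S ⊆ P.erase v, S.card = m ∧ ∀ u ∈ S, ∀ w ∈ S, u ≠ w →
      2 * dist u v < dist w v ∨ 2 * dist w v < dist u v := by
  induction m with
  | zero =>
    intro P hP
    obtain ⟨v, hv⟩ : P.Nonempty := Finset.card_pos.1 (by simpa using hP)
    exact ⟨v, hv, ∅, by simp, by simp, by simp⟩
  | succ m ih =>
    intro P hP
    have hpow : 1 ≤ 169 ^ m := Nat.one_le_pow _ _ (by norm_num)
    rw [pow_succ] at hP
    have hne : P.Nonempty := Finset.card_pos.1 (by omega)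
    obtain ⟨⟨a, b⟩, hab, hmax⟩ := (P ×ˢ P).exists_max_image (fun x => dist x.1 x.2)
      (hne.product hne)
    obtain ⟨ha, hb⟩ := Finset.mem_product.1 hab
    set D := dist a b with hD
    have hmax' : ∀ x ∈ P, ∀ y ∈ P, dist x y ≤ D := fun x hx y hy =>
      hmax (x, y) (Finset.mem_product.2 ⟨hx, hy⟩)
    have hDpos : 0 < D := by
      obtain ⟨x, hx, y, hy, hxy⟩ := Finset.one_lt_card.1 (by omega : 1 < P.card)
      exact (dist_pos.2 hxy).trans_le (hmax' x hx y hy)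
    set s := D / 6 with hs
    have hspos : 0 < s := by positivity
    let cell : ℂ → ℤ × ℤ := fun x => (⌊(x - a).re / s⌋, ⌊(x - a).im / s⌋)
    have hcoord : ∀ t : ℝ, |t| ≤ D → ⌊t / s⌋ ∈ Finset.Icc (-6 : ℤ) 6 := by
      intro t ht
      rw [abs_le] at ht
      rw [Finset.mem_Icc, Int.le_floor, ← Int.lt_add_one_iff, Int.floor_lt, le_div_iff₀ hspos,
        div_lt_iff₀ hspos]
      push_cast
      constructor <;> linarith
    have hmaps : ∀ x ∈ P, cell x ∈ Finset.Icc (-6 : ℤ) 6 ×ˢ Finset.Icc (-6 : ℤ) 6 := by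
      intro x hx
      have hxa : ‖x - a‖ ≤ D := by rw [← dist_eq_norm]; exact hmax' x hx a ha
      exact Finset.mem_product.2 ⟨hcoord _ ((Complex.abs_re_le_norm _).trans hxa),
        hcoord _ ((Complex.abs_im_le_norm _).trans hxa)⟩
    obtain ⟨y, -, hy⟩ := Finset.exists_le_card_fiber_of_mul_le_card_of_maps_to (n := 169 ^ m)
      hmaps ⟨(0, 0), by simp⟩ (by
        rw [Finset.card_product, show (Finset.Icc (-6 : ℤ) 6).card = 13 by simp]
        omega)
    obtain ⟨v, hv, S, hS, hcard, hsep⟩ := ih _ hy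
    have hvP := (Finset.mem_filter.1 hv).1
    have hclose : ∀ u ∈ S, 2 * dist u v < D / 2 := by
      intro u hu
      have hu' := (Finset.mem_filter.1 (Finset.mem_of_mem_erase (hS hu))).2
      have hcell : cell u = cell v := hu'.trans (Finset.mem_filter.1 hv).2.symm
      have := dist_lt_of_floor_eq hspos (congrArg Prod.fst hcell) (congrArg Prod.snd hcell)
      linarith
    obtain ⟨x, hx, hxv⟩ : ∃ x ∈ P, D / 2 ≤ dist x v := by
      by_contra! hcon
      have h1 := hcon a ha
      have h2 := hcon b hb
      have h3 := dist_triangle_right a b v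
      linarith
    have hxS : x ∉ S := by
      intro h
      have := hclose x h
      linarith
    refine ⟨v, hvP, insert x S, ?_, by rw [Finset.card_insert_of_notMem hxS, hcard], ?_⟩
    · refine Finset.insert_subset (Finset.mem_erase.2 ⟨?_, hx⟩) fun u hu => ?_
      · rintro rfl
        rw [dist_self] at hxv
        linarith
      · obtain ⟨h1, h2⟩ := Finset.mem_erase.1 (hS hu)
        exact Finset.mem_erase.2 ⟨h1, (Finset.mem_filter.1 h2).1⟩
    · intro u hu w hw huw
      rcases Finset.mem_insert.1 hu with hux | hu' <;>
        rcases Finset.mem_insert.1 hw with hwx | hw'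
      · exact (huw (hux.trans hwx.symm)).elim
      · exact Or.inr (hux ▸ (hclose w hw').trans_le hxv)
      · exact Or.inl (hwx ▸ (hclose u hu').trans_le hxv)
      · exact hsep u hu' w hw' huw

theorem log_le_yaoD_one {n : ℕ} (hn : 1 ≤ n) : Nat.log 169 n ≤ yaoD 1 n := by
  refine le_yaoD_of_potential fun P hP _ => ?_
  obtain ⟨v, hv, S, hS, hcard, hsep⟩ := exists_separated_distances (Nat.log 169 n) P
    (by rw [hP]; exact Nat.pow_log_le_self _ (by omega))
  obtain ⟨c, hc⟩ := exists_sector_choice one_pos v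
  refine ⟨v, hv, S, hS, hcard.ge, c, fun u => dist u v,
    fun u hu => hc u (Finset.ne_of_mem_erase (hS hu)), fun u hu w hw hs hd => ?_⟩
  have huw : u ≠ w := by
    rintro rfl
    exact zero_notMem_sector 1 (c u) (by simpa using hs)
  -- If `w` were more than twice as far from `v` as `u`, then `w` would be farther from `u` than `v`
  -- is and could not block.
  have h1 := dist_triangle_left w v u
  rcases hsep u hu w hw huw with h | h
  · linarith
  · linarith [dist_nonneg (x := w) (y := v)]

/-- Doubling makes the binary logarithms of the values distinct. -/
theorem card_le_log_of_doubling {n : ℕ} {T : Finset ℕ} {d : ℕ → ℕ} (hd : ∀ u ∈ T, d u ≤ n)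
    (h0 : ∀ u ∈ T, d u ≠ 0)
    (h : ∀ u ∈ T, ∀ r ∈ T, u ≠ r → 2 * d u ≤ d r ∨ 2 * d r ≤ d u) :
    T.card ≤ Nat.log 2 n + 1 := by
  have double : ∀ u ∈ T, ∀ r, 2 * d u ≤ d r → Nat.log 2 (d u) < Nat.log 2 (d r) := by
    intro u hu r hr
    have := Nat.log_mono_right (b := 2) hr
    rw [mul_comm, Nat.log_mul_base (by norm_num) (h0 u hu)] at this
    omega
  rw [← Finset.card_range (Nat.log 2 n + 1)]
  refine Finset.card_le_card_of_injOn (fun u => Nat.log 2 (d u)) ?_ ?_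
  · intro u hu
    have := Nat.log_mono_right (b := 2) (hd u hu)
    simpa using Nat.lt_succ_of_le this
  · intro u hu r hr hur
    by_contra hne
    rcases h u hu r hr hne with h' | h'
    · exact (double u hu r h').ne hur
    · exact (double r hr u h').ne hur.symm

theorem yaoD_one_le_log (n : ℕ) : yaoD 1 n ≤ 2 * (Nat.log 2 n + 1) := by
  refine yaoD_le_of_family (fun i => Metric.ball (i : ℂ) (1 / 4)) (fun _ => Metric.isOpen_ball)
    (fun i => ⟨i, Metric.mem_ball_self (by norm_num)⟩) ?_
  intro p hp S hS v hv hvS pos hpos hadj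
  have near : ∀ a < n, ∀ b < n, |dist (p a) (p b) - abs ((a : ℝ) - b)| < 1 / 2 := by
    intro a ha b hb
    have h1 := Metric.mem_ball.1 (hp a ha)
    have h2 := Metric.mem_ball.1 (hp b hb)
    have h3 : dist (a : ℂ) b = |(a : ℝ) - b| := by
      rw [dist_eq_norm, ← Real.norm_eq_abs, ← Complex.norm_real]
      push_cast
      rfl
    have h4 := dist_dist_dist_le (p a) (p b) a b
    rw [h3, Real.dist_eq] at h4
    linarith
  -- With one sector every predecessor competes with `v`. The perturbation changes each distance by
  -- less than 1/2, so the comparison survives between the integer distances.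
  have step : ∀ u ∈ S, ∀ r ∈ S, pos r < pos u → |(u : ℤ) - v| ≤ |(u : ℤ) - r| := by
    intro u hu r hr hlt
    have hun := Finset.mem_range.1 (hS hu)
    have hrn := Finset.mem_range.1 (hS hr)
    obtain ⟨-, i, hi, -, hmin⟩ := hadj u hu
    have hne : p r - p u ≠ 0 := by
      intro h0
      have h1 := near u hun r hrn
      rw [← sub_eq_zero.1 h0, dist_self, zero_sub, abs_neg, abs_abs] at h1
      have h2 : |(u : ℤ) - r| < 1 := by
        have : |(u : ℝ) - r| < 1 := by linarith
        exact_mod_cast this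
      rw [Int.abs_lt_one_iff] at h2
      have : r = u := by omega
      exact hlt.ne (by rw [this])
    obtain ⟨j, hj, hs⟩ := exists_mem_sector one_pos hne
    obtain rfl : j = i := by omega
    have h1 := hmin r hrn hlt hs
    have h2 := abs_lt.1 (near u hun v hv)
    have h3 := abs_lt.1 (near u hun r hrn)
    have h4 : |(u : ℝ) - v| < |(u : ℝ) - r| + 1 := by linarith
    have h5 : |(u : ℤ) - v| < |(u : ℤ) - r| + 1 := by exact_mod_cast h4
    omega
  have hor : ∀ u ∈ S, ∀ r ∈ S, u ≠ r →
      |(u : ℤ) - v| ≤ |(u : ℤ) - r| ∨ |(r : ℤ) - v| ≤ |(r : ℤ) - u| := by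
    intro u hu r hr hne
    rcases lt_trichotomy (pos r) (pos u) with h | h | h
    · exact Or.inl (step u hu r hr h)
    · exact (hne (hpos (hS hr) (hS hu) h).symm).elim
    · exact Or.inr (step r hr u hu h)
  -- For two points on the same side of `v`, being at least as far from each other as one is from
  -- `v` means that the other is at least twice as far from `v`.
  have hR : (S.filter (v < ·)).card ≤ Nat.log 2 n + 1 := by
    refine card_le_log_of_doubling (d := fun u => u - v) ?_ ?_ ?_
    · intro u hu
      have := Finset.mem_range.1 (hS (Finset.mem_filter.1 hu).1)
      omega
    · intro u hu
      have := (Finset.mem_filter.1 hu).2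
      omega
    · intro u hu r hr hne
      obtain ⟨huS, hu⟩ := Finset.mem_filter.1 hu
      obtain ⟨hrS, hr⟩ := Finset.mem_filter.1 hr
      have := hor u huS r hrS hne
      simp only [Int.abs_eq_natAbs] at this
      omega
  have hL : (S.filter (¬ v < ·)).card ≤ Nat.log 2 n + 1 := by
    have hlt : ∀ u ∈ S.filter (¬ v < ·), u < v ∧ u ∈ S := by
      intro u hu
      obtain ⟨huS, hu⟩ := Finset.mem_filter.1 hu
      exact ⟨lt_of_le_of_ne (not_lt.1 hu) fun h => hvS (h ▸ huS), huS⟩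
    refine card_le_log_of_doubling (d := fun u => v - u) ?_ ?_ ?_
    · intro u hu
      omega
    · intro u hu
      have := hlt u hu
      omega
    · intro u hu r hr hne
      obtain ⟨hu, huS⟩ := hlt u hu
      obtain ⟨hr, hrS⟩ := hlt r hr
      have := hor u huS r hrS hne
      simp only [Int.abs_eq_natAbs] at this
      omega
  have := Finset.card_filter_add_card_filter_not (s := S) (v < ·)
  omega

theorem yaoD_one_isTheta_log :
    (fun n : ℕ => (yaoD 1 n : ℝ)) =Θ[atTop] (fun n : ℕ => Real.log (n : ℝ)) := by
  constructor
  · refine IsBigO.of_bound (4 / Real.log 2) ?_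
    filter_upwards [eventually_ge_atTop 2] with n hn
    have hl2 : 0 < Real.log 2 := Real.log_pos (by norm_num)
    have hn0 : (2 : ℝ) ≤ n := by exact_mod_cast hn
    have hln : Real.log 2 ≤ Real.log n := Real.log_le_log (by norm_num) hn0
    have h1 : (yaoD 1 n : ℝ) ≤ 2 * (Nat.log 2 n + 1) := by exact_mod_cast yaoD_one_le_log n
    have h2 : (Nat.log 2 n : ℝ) * Real.log 2 ≤ Real.log n := by
      rw [← Real.log_pow]
      refine Real.log_le_log (by positivity) ?_
      exact_mod_cast Nat.pow_log_le_self 2 (by omega)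
    rw [Real.norm_of_nonneg (Nat.cast_nonneg _), Real.norm_of_nonneg (hl2.le.trans hln),
      div_mul_eq_mul_div, le_div_iff₀ hl2]
    nlinarith
  · refine IsBigO.of_bound (2 * Real.log 169) ?_
    filter_upwards [eventually_ge_atTop 169] with n hn
    have hl : 0 < Real.log 169 := Real.log_pos (by norm_num)
    have hn0 : (169 : ℝ) ≤ n := by exact_mod_cast hn
    have hln : 0 ≤ Real.log n := Real.log_nonneg (by linarith)
    have h1 : (Nat.log 169 n : ℝ) ≤ yaoD 1 n := by exact_mod_cast log_le_yaoD_one (by omega)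
    have h2 : Real.log n ≤ (Nat.log 169 n + 1) * Real.log 169 := by
      have : (n : ℝ) ≤ 169 ^ (Nat.log 169 n + 1) := by
        exact_mod_cast (Nat.lt_pow_succ_log_self (by norm_num) n).le
      have := Real.log_le_log (by linarith) this
      rw [Real.log_pow] at this
      exact_mod_cast this
    have h3 : (1 : ℝ) ≤ Nat.log 169 n := by
      exact_mod_cast Nat.log_pos (by norm_num) hn
    rw [Real.norm_of_nonneg (Nat.cast_nonneg _), Real.norm_of_nonneg hln]
    nlinarith

/-! ### Upper bound for three sectors -/

theorem inner_nonneg_of_mem_sector {k i : ℕ} {z : ℂ} (h : z ∈ sector k i) {α : ℝ}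
    (h1 : α - Real.pi / 2 ≤ 2 * Real.pi * i / k)
    (h2 : 2 * Real.pi * (i + 1) / k ≤ α + Real.pi / 2) :
    0 ≤ z.re * Real.cos α + z.im * Real.sin α := by
  obtain ⟨r, θ, hr, ha, hb, hre, him, -⟩ := sector_polar h
  have : z.re * Real.cos α + z.im * Real.sin α = r * Real.cos (θ - α) := by
    rw [hre, him, Real.cos_sub]; ring
  rw [this]
  exact mul_nonneg hr.le (Real.cos_nonneg_of_mem_Icc ⟨by linarith, by linarith⟩)

theorem sector_three_zero {z : ℂ} (h : z ∈ sector 3 0) : 0 ≤ z.im ∧ 0 ≤ √3 * z.re + z.im := by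
  have hpi := Real.pi_pos
  have h1 := inner_nonneg_of_mem_sector h (α := Real.pi / 2) (by push_cast; linarith)
    (by push_cast; linarith)
  have h2 := inner_nonneg_of_mem_sector h (α := Real.pi / 6) (by push_cast; linarith)
    (by push_cast; linarith)
  rw [Real.cos_pi_div_two, Real.sin_pi_div_two] at h1
  rw [Real.cos_pi_div_six, Real.sin_pi_div_six] at h2
  constructor <;> linarith

theorem sector_three_one {z : ℂ} (h : z ∈ sector 3 1) :
    √3 * z.re + z.im ≤ 0 ∧ √3 * z.re - z.im ≤ 0 := by
  have hpi := Real.pi_pos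
  have h1 := inner_nonneg_of_mem_sector h (α := Real.pi / 6 + Real.pi) (by push_cast; linarith)
    (by push_cast; linarith)
  have h2 := inner_nonneg_of_mem_sector h (α := Real.pi - Real.pi / 6) (by push_cast; linarith)
    (by push_cast; linarith)
  rw [Real.cos_add_pi, Real.sin_add_pi, Real.cos_pi_div_six, Real.sin_pi_div_six] at h1
  rw [Real.cos_pi_sub, Real.sin_pi_sub, Real.cos_pi_div_six, Real.sin_pi_div_six] at h2
  constructor <;> linarith

theorem sector_three_two {z : ℂ} (h : z ∈ sector 3 2) : z.im ≤ 0 ∧ 0 ≤ √3 * z.re - z.im := by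
  have hpi := Real.pi_pos
  have h1 := inner_nonneg_of_mem_sector h (α := Real.pi / 2 + Real.pi) (by push_cast; linarith)
    (by push_cast; linarith)
  have h2 := inner_nonneg_of_mem_sector h (α := 2 * Real.pi - Real.pi / 6)
    (by push_cast; linarith) (by push_cast; linarith)
  rw [Real.cos_add_pi, Real.sin_add_pi, Real.cos_pi_div_two, Real.sin_pi_div_two] at h1
  rw [Real.cos_two_pi_sub, Real.sin_two_pi_sub, Real.cos_pi_div_six, Real.sin_pi_div_six] at h2
  constructor <;> linarith

/-- The sector containing all points whose coordinates differ by less than `1` from the integers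
`X` and `Y`, provided that they lie well inside a sector; otherwise the value is `3`. -/
def robustSector (X Y : ℤ) : ℕ :=
  if 1 < Y ∧ 0 < 7 * (X - 1) + 4 * (Y - 1) then 0
  else if X < -1 ∧ 17 * (X + 1) + 10 * (Y + 1) < 0 ∧ 17 * (X + 1) - 10 * (Y - 1) < 0 then 1
  else if Y < -1 ∧ 0 < 7 * (X - 1) - 4 * (Y + 1) then 2
  else 3

/-- The integer tests use `17 / 10 < √3 < 7 / 4` and leave room for an error of 1 in each
coordinate; they exclude the two other sectors. -/
theorem mem_sector_of_robustSector {X Y : ℤ} {z : ℂ} (hre : |z.re - X| < 1)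
    (him : |z.im - Y| < 1) (h : robustSector X Y < 3) : z ∈ sector 3 (robustSector X Y) := by
  obtain ⟨hx1, hx2⟩ := abs_lt.1 hre
  obtain ⟨hy1, hy2⟩ := abs_lt.1 him
  have hs1 : (17 / 10 : ℝ) < √3 := Real.lt_sqrt_of_sq_lt (by norm_num)
  have hs2 : √3 < (7 / 4 : ℝ) := (Real.sqrt_lt' (by norm_num)).2 (by norm_num)
  have sectors : z ≠ 0 → z ∈ sector 3 0 ∨ z ∈ sector 3 1 ∨ z ∈ sector 3 2 := by
    intro hz
    obtain ⟨i, hi, hzi⟩ := exists_mem_sector (by norm_num : 0 < 3) hz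
    interval_cases i <;> simp [hzi]
  have sqrt_pos : ∀ t : ℝ, 0 < t → 0 < 7 * z.re + 4 * t → 0 < √3 * z.re + t := by
    intro t ht h
    rcases le_or_gt 0 z.re with h0 | h0
    · positivity
    · nlinarith
  unfold robustSector at h ⊢
  split_ifs at h ⊢ with c0 c1 c2
  · have a1 : (1 : ℝ) < Y := by exact_mod_cast c0.1
    have a2 : (0 : ℝ) < 7 * (X - 1) + 4 * (Y - 1) := by exact_mod_cast c0.2
    have hy : 0 < z.im := by linarith
    have := sqrt_pos z.im hy (by linarith)
    rcases sectors (by rintro rfl; simp at hy) with h' | h' | h'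
    · exact h'
    · linarith [(sector_three_one h').1]
    · linarith [(sector_three_two h').1]
  · have a1 : (X : ℝ) < -1 := by exact_mod_cast c1.1
    have a2 : 17 * ((X : ℝ) + 1) + 10 * (Y + 1) < 0 := by exact_mod_cast c1.2.1
    have a3 : 17 * ((X : ℝ) + 1) - 10 * (Y - 1) < 0 := by exact_mod_cast c1.2.2
    have hx : z.re < 0 := by linarith
    have hm : √3 * z.re < 17 / 10 * z.re := mul_lt_mul_of_neg_right hs1 hx
    rcases sectors (by rintro rfl; simp at hx) with h' | h' | h'
    · linarith [(sector_three_zero h').2]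
    · exact h'
    · linarith [(sector_three_two h').2]
  · have a1 : (Y : ℝ) < -1 := by exact_mod_cast c2.1
    have a2 : (0 : ℝ) < 7 * (X - 1) - 4 * (Y + 1) := by exact_mod_cast c2.2
    have hy : z.im < 0 := by linarith
    have := sqrt_pos (-z.im) (by linarith) (by linarith)
    rcases sectors (by rintro rfl; simp at hy) with h' | h' | h'
    · linarith [(sector_three_zero h').1]
    · linarith [(sector_three_one h').2]
    · exact h'
  · omega

theorem norm_lt_of_natAbs {X Y X' Y' : ℤ} {z w : ℂ} (hzx : |z.re - X| < 1) (hzy : |z.im - Y| < 1)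
    (hwx : |w.re - X'| < 1) (hwy : |w.im - Y'| < 1)
    (h : (X.natAbs + 1) ^ 2 + (Y.natAbs + 1) ^ 2 ≤ (X'.natAbs - 1) ^ 2 + (Y'.natAbs - 1) ^ 2) :
    ‖z‖ < ‖w‖ := by
  have upper : ∀ {t : ℝ} {A : ℤ}, |t - A| < 1 → t ^ 2 < ((A.natAbs + 1 : ℕ) : ℝ) ^ 2 := by
    intro t A ht
    have h1 := abs_sub_abs_le_abs_sub t A
    rw [← sq_abs t]
    push_cast [Nat.cast_natAbs]
    exact pow_lt_pow_left₀ (by linarith) (abs_nonneg t) two_ne_zero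
  -- Truncated subtraction is intended: for `A = 0` the lower bound is `0`.
  have lower : ∀ {t : ℝ} {A : ℤ}, |t - A| < 1 → ((A.natAbs - 1 : ℕ) : ℝ) ^ 2 ≤ t ^ 2 := by
    intro t A ht
    rw [← sq_abs t]
    refine pow_le_pow_left₀ (Nat.cast_nonneg _) ?_ 2
    rcases Nat.eq_zero_or_pos A.natAbs with h0 | h0
    · simp [h0]
    · have h1 := abs_sub_abs_le_abs_sub (A : ℝ) t
      rw [abs_sub_comm] at h1
      push_cast [Nat.cast_sub (show 1 ≤ A.natAbs from h0), Nat.cast_natAbs]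
      linarith
  have h' : ((X.natAbs + 1 : ℕ) : ℝ) ^ 2 + ((Y.natAbs + 1 : ℕ) : ℝ) ^ 2 ≤
      ((X'.natAbs - 1 : ℕ) : ℝ) ^ 2 + ((Y'.natAbs - 1 : ℕ) : ℝ) ^ 2 := by exact_mod_cast h
  refine lt_of_pow_lt_pow_left₀ 2 (norm_nonneg w) ?_
  rw [← Complex.normSq_eq_norm_sq, ← Complex.normSq_eq_norm_sq, Complex.normSq_apply,
    Complex.normSq_apply]
  linarith [upper hzx, upper hzy, lower hwx, lower hwy]

/-- The abscissas of six points such that every point `v` of them sees two other points, each of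
which blocks the other one from sending an edge to `v` in the three-sector ordered Yao graph. -/
def blockedX : Fin 6 → ℤ := ![-6, 16, -8, -21, 23, -15]

/-- The ordinates of the six points. -/
def blockedY : Fin 6 → ℤ := ![23, -3, -21, 12, 5, -17]

/-- The indices of the first points of the mutually blocking pairs. -/
def blockerFst : Fin 6 → Fin 6 := ![1, 3, 0, 1, 3, 0]

/-- The indices of the second points of the mutually blocking pairs. -/
def blockerSnd : Fin 6 → Fin 6 := ![2, 5, 4, 2, 5, 4]

/-- Robust form of the statement that the point number `b` blocks the point number `a` from
sending an edge to the point number `c`. -/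
def RobustlyBlocks (c a b : Fin 6) : Prop :=
  robustSector (blockedX c - blockedX a) (blockedY c - blockedY a) < 3 ∧
  robustSector (blockedX b - blockedX a) (blockedY b - blockedY a) =
    robustSector (blockedX c - blockedX a) (blockedY c - blockedY a) ∧
  ((blockedX b - blockedX a).natAbs + 1) ^ 2 + ((blockedY b - blockedY a).natAbs + 1) ^ 2 ≤
    ((blockedX c - blockedX a).natAbs - 1) ^ 2 + ((blockedY c - blockedY a).natAbs - 1) ^ 2

/-- A finite integer check. Three disjoint pairs `{1, 2}`, `{3, 5}`, `{0, 4}` occur, each serving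
two targets. -/
theorem robustlyBlocks_pair (c : Fin 6) :
    RobustlyBlocks c (blockerFst c) (blockerSnd c) ∧
      RobustlyBlocks c (blockerSnd c) (blockerFst c) ∧
      blockerFst c ≠ c ∧ blockerSnd c ≠ c ∧ blockerFst c ≠ blockerSnd c := by
  unfold RobustlyBlocks
  revert c
  decide

theorem RobustlyBlocks.not_closest {c a b : Fin 6} (h : RobustlyBlocks c a b) {p : Fin 6 → ℂ}
    (hre : ∀ i, |(p i).re - blockedX i| < 1 / 2) (him : ∀ i, |(p i).im - blockedY i| < 1 / 2)
    {i : ℕ} (hi : i < 3) (hs : p c - p a ∈ sector 3 i) :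
    p b - p a ∈ sector 3 i ∧ dist (p a) (p b) < dist (p a) (p c) := by
  have hx : ∀ j l, |(p j - p l).re - (blockedX j - blockedX l : ℤ)| < 1 := by
    intro j l
    have h1 := abs_lt.1 (hre j)
    have h2 := abs_lt.1 (hre l)
    rw [Complex.sub_re, abs_lt]
    push_cast
    constructor <;> linarith
  have hy : ∀ j l, |(p j - p l).im - (blockedY j - blockedY l : ℤ)| < 1 := by
    intro j l
    have h1 := abs_lt.1 (him j)
    have h2 := abs_lt.1 (him l)
    rw [Complex.sub_im, abs_lt]
    push_cast
    constructor <;> linarith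
  obtain ⟨h1, h2, h3⟩ := h
  have hc := mem_sector_of_robustSector (hx c a) (hy c a) h1
  have hb := mem_sector_of_robustSector (hx b a) (hy b a) (h2 ▸ h1)
  rw [h2, sector_index_unique h1 hi hc hs] at hb
  refine ⟨hb, ?_⟩
  rw [dist_comm, dist_comm (p a), dist_eq_norm, dist_eq_norm]
  exact norm_lt_of_natAbs (hx b a) (hy b a) (hx c a) (hy c a) h3

theorem card_filter_ofNat_ne_le {n : ℕ} (c : Fin 6) :
    ((Finset.range n).filter fun j => Fin.ofNat 6 j ≠ c).card ≤ 5 * ((n + 5) / 6) := by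
  have hcard : ((Finset.univ.erase c) ×ˢ Finset.range ((n + 5) / 6)).card =
      5 * ((n + 5) / 6) := by
    rw [Finset.card_product, Finset.card_erase_of_mem (Finset.mem_univ c), Finset.card_univ,
      Fintype.card_fin, Finset.card_range]
  rw [← hcard]
  refine Finset.card_le_card_of_injOn (fun j => (Fin.ofNat 6 j, j / 6)) ?_ ?_
  · intro j hj
    obtain ⟨hj, hjc⟩ := Finset.mem_filter.1 hj
    rw [Finset.mem_range] at hj
    refine Finset.mem_product.2 ⟨Finset.mem_erase.2 ⟨hjc, Finset.mem_univ _⟩,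
      Finset.mem_range.2 ?_⟩
    show j / 6 < _
    omega
  · intro i _ j _ h
    obtain ⟨h1, h2⟩ := Prod.mk.inj h
    have h3 : i % 6 = j % 6 := congrArg Fin.val h1
    omega

theorem yaoD_three_le {n : ℕ} : yaoD 3 n ≤ 5 * ((n + 5) / 6) - 1 := by
  let z : ℕ → ℂ := fun j => ⟨blockedX (Fin.ofNat 6 j), blockedY (Fin.ofNat 6 j)⟩
  refine yaoD_le_of_family (fun j => Metric.ball (z j) (1 / 2)) (fun _ => Metric.isOpen_ball)
    (fun j => ⟨z j, Metric.mem_ball_self (by norm_num)⟩) ?_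
  intro p hp S hS v hv hvS pos hpos hadj
  have hre : ∀ j < n, |(p j).re - blockedX (Fin.ofNat 6 j)| < 1 / 2 := by
    intro j hj
    have := Metric.mem_ball.1 (hp j hj)
    rw [dist_eq_norm] at this
    exact (Complex.abs_re_le_norm (p j - z j)).trans_lt this
  have him : ∀ j < n, |(p j).im - blockedY (Fin.ofNat 6 j)| < 1 / 2 := by
    intro j hj
    have := Metric.mem_ball.1 (hp j hj)
    rw [dist_eq_norm] at this
    exact (Complex.abs_im_le_norm (p j - z j)).trans_lt this
  have block : ∀ u ∈ S, ∀ w ∈ S,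
      RobustlyBlocks (Fin.ofNat 6 v) (Fin.ofNat 6 u) (Fin.ofNat 6 w) →
      Fin.ofNat 6 u ≠ Fin.ofNat 6 v → Fin.ofNat 6 w ≠ Fin.ofNat 6 v →
      Fin.ofNat 6 u ≠ Fin.ofNat 6 w → ¬ pos w < pos u := by
    intro u hu w hw hb huv hwv huw hlt
    have hun := Finset.mem_range.1 (hS hu)
    have hwn := Finset.mem_range.1 (hS hw)
    obtain ⟨-, i, hi, hs, hmin⟩ := hadj u hu
    -- One representative per cluster: the three points at issue, and the unperturbed centre in the
    -- other clusters.
    let q : Fin 6 → ℂ := fun c => if c = Fin.ofNat 6 v then p v else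
      if c = Fin.ofNat 6 u then p u else if c = Fin.ofNat 6 w then p w else
      ⟨blockedX c, blockedY c⟩
    have hqv : q (Fin.ofNat 6 v) = p v := if_pos rfl
    have hqu : q (Fin.ofNat 6 u) = p u := by simp only [q, if_neg huv, if_true]
    have hqw : q (Fin.ofNat 6 w) = p w := by simp only [q, if_neg hwv, if_neg huw.symm, if_true]
    have hq1 : ∀ c, |(q c).re - blockedX c| < 1 / 2 := by
      intro c
      simp only [q]
      split_ifs with h1 h2 h3
      · rw [h1]; exact hre v hv
      · rw [h2]; exact hre u hun
      · rw [h3]; exact hre w hwn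
      · simp
    have hq2 : ∀ c, |(q c).im - blockedY c| < 1 / 2 := by
      intro c
      simp only [q]
      split_ifs with h1 h2 h3
      · rw [h1]; exact him v hv
      · rw [h2]; exact him u hun
      · rw [h3]; exact him w hwn
      · simp
    have := hb.not_closest hq1 hq2 hi (by rwa [hqv, hqu])
    rw [hqv, hqu, hqw] at this
    exact (hmin w hwn hlt this.1).not_gt this.2
  obtain ⟨hab, hba, hav, hbv, hne⟩ := robustlyBlocks_pair (Fin.ofNat 6 v)
  -- If both blocking clusters met `S`, neither of two representatives could precede the other.
  have missed : ∃ c, c ≠ Fin.ofNat 6 v ∧ ∀ u ∈ S, Fin.ofNat 6 u ≠ c := by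
    by_contra! hcon
    obtain ⟨a, haS, ha⟩ := hcon _ hav
    obtain ⟨b, hbS, hb⟩ := hcon _ hbv
    rw [← ha, ← hb] at hab hba hne
    rw [← ha] at hav
    rw [← hb] at hbv
    have h1 := block a haS b hbS hab hav hbv hne
    have h2 := block b hbS a haS hba hbv hav hne.symm
    have h3 := hpos (hS haS) (hS hbS) (le_antisymm (not_lt.1 h1) (not_lt.1 h2))
    exact hne (congrArg _ h3)
  obtain ⟨c, hcv, hc⟩ := missed
  -- The point `v` itself lies in one of the five remaining clusters; removing it yields the `- 1`.
  have hsub : S ⊆ ((Finset.range n).filter fun j => Fin.ofNat 6 j ≠ c).erase v := fun u hu =>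
    Finset.mem_erase.2 ⟨fun h => hvS (h ▸ hu), Finset.mem_filter.2 ⟨hS hu, hc u hu⟩⟩
  have h1 := Finset.card_le_card hsub
  rw [Finset.card_erase_of_mem (Finset.mem_filter.2 ⟨Finset.mem_range.2 hv, hcv.symm⟩)] at h1
  have h2 := card_filter_ofNat_ne_le (n := n) c
  omega

/-! ### Passage from natural-number bounds to the stated form -/

theorem ceil_div_six (n : ℕ) : ⌈(n : ℝ) / 6⌉ = (((n + 5) / 6 : ℕ) : ℤ) := by
  rw [Int.ceil_eq_iff]
  have h1 : (n + 5) / 6 * 6 < n + 6 := by omega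
  have h2 : n ≤ (n + 5) / 6 * 6 := by omega
  have h1' : (((n + 5) / 6 : ℕ) : ℝ) * 6 < n + 6 := by exact_mod_cast h1
  have h2' : (n : ℝ) ≤ (((n + 5) / 6 : ℕ) : ℝ) * 6 := by exact_mod_cast h2
  rw [Int.cast_natCast]
  constructor <;> linarith

theorem mainTheorem1 :
    -- the maximum that defines `d_k(n)` exists
    (∀ k n : ℕ, 1 ≤ k → 1 ≤ n → IsGreatest (guaranteedIndegrees k n) (yaoD k n)) ∧
    -- `d_1(n) = Θ(log n)`
    ((fun n : ℕ => (yaoD 1 n : ℝ)) =Θ[atTop] (fun n : ℕ => Real.log (n : ℝ))) ∧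
    -- bounds on `d_3(n)`
    (∀ n : ℕ, 1 ≤ n →
      (1 / 2 : ℝ) * ((n : ℝ) - 1) ≤ (yaoD 3 n : ℝ) ∧
      (yaoD 3 n : ℤ) ≤ 5 * ⌈(n : ℝ) / 6⌉ - 1) ∧
    -- bounds on `d_5(n)`
    (∀ n : ℕ, 1 ≤ n →
      (2 / 3 : ℝ) * ((n : ℝ) - 1) ≤ (yaoD 5 n : ℝ) ∧
      (yaoD 5 n : ℝ) ≤ (n : ℝ) - 1) ∧
    -- the remaining values of `k`
    (∀ k n : ℕ, k = 2 ∨ k = 4 ∨ 6 ≤ k → 1 ≤ n → (yaoD k n : ℝ) = (n : ℝ) - 1) := by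
  have upper : ∀ k n : ℕ, 1 ≤ n → (yaoD k n : ℝ) ≤ (n : ℝ) - 1 := by
    intro k n hn
    have h : yaoD k n + 1 ≤ n := by
      have := yaoD_le_pred k n
      omega
    have h' : (yaoD k n : ℝ) + 1 ≤ n := by exact_mod_cast h
    linarith
  refine ⟨fun k n _ _ => isGreatest_yaoD k n, yaoD_one_isTheta_log, fun n hn => ⟨?_, ?_⟩,
    fun n hn => ⟨?_, upper 5 n hn⟩, fun k n hk hn => le_antisymm (upper k n hn) ?_⟩
  · have h : n ≤ 2 * yaoD 3 n + 1 := by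
      have := half_le_yaoD_three hn
      omega
    have h' : (n : ℝ) ≤ 2 * yaoD 3 n + 1 := by exact_mod_cast h
    linarith
  · have := yaoD_three_le (n := n)
    rw [ceil_div_six]
    omega
  · have h : 2 * n ≤ 3 * yaoD 5 n + 2 := by
      have := two_thirds_le_yaoD_five hn
      omega
    have h' : (2 : ℝ) * n ≤ 3 * yaoD 5 n + 2 := by exact_mod_cast h
    linarith
  · have h : n - 1 ≤ yaoD k n := by
      rcases hk with rfl | rfl | hk
      · exact pred_le_yaoD_of_even one_pos hn
      · exact pred_le_yaoD_of_even two_pos hn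
      · exact pred_le_yaoD_of_six_le hk hn
    have h' : (n : ℝ) ≤ yaoD k n + 1 := by
      have : n ≤ yaoD k n + 1 := by omega
      exact_mod_cast this
    linarith
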